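/- Let $K$ be an uncountable algebraically closed field of characteristic zero, $n\ge 0$, and let $R=K[[t]]$ with the derivation $d=d/dt$. Let $R\{x_1,\dots,x_n\}$ be the ring of differential polynomials, i.e. the polynomial ring $R[x_{ij}: 1\le i\le n,\ j\ge 0]$ with the derivation $d$ that extends $d/dt$ and satisfies $d(x_{ij})=x_{i(j+1)}$. A differential polynomial $P$ is evaluated at $\varphi\in R^n$ by substituting $x_{ij}\mapsto d^j\varphi_i$, and $\mathrm{Sol}(\Sigma)=\{\varphi\in R^n : P(\varphi)=0 \text{ for all } P\in\Sigma\}$. Let $\Psi:(K^{\mathbb{Z}_{\ge0}})^n\to R^n$ be the map $(a_{ij})\mapsto\bigl(\sum_{j\ge0}\tfrac{1}{j!}a_{ij}t^j\bigr)_{1\le i\le n}$. Let $G\subset R\{x_1,\dots,x_n\}$ be a differential ideal (an ideal with $d(G)\subset G$), and let $f_1,\dots,f_s\in G$ be such that $\mathrm{Sol}(G)=\bigcap_{\ell=1}^s\mathrm{Sol}(f_\ell)$. Put $F_{\ell k}=(d^kf_\ell)|_{t=0}\in K[x_{ij}: 1\le i\le n,\ j\ge0]$, the polynomial obtained from $d^kf_\ell$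 by setting $t=0$ in its coefficients. For $m\ge 0$ let $N_m$ be the smallest positive integer such that $F_{\ell k}\in K[x_{ij}: 1\le i\le n,\ 0\le j\le N_m]$ for all $1\le\ell\le s$ and $0\le k\le m$. Let $S=(S_1,\dots,S_n)$ be a tuple of subsets of $\mathbb{Z}_{\ge0}$, and set \[ A_{\infty,S}=\{a\in(K^{\mathbb{Z}_{\ge0}})^n : F_{\ell k}(a)=0 \text{ for } 1\le\ell\le s,\ k\ge0,\text{ and for all } i,j:\ a_{ij}=0\iff j\notin S_i\}, \] \[ A_{m,S}=\{a\in(K^{N_m+1})^n : F_{\ell k}(a)=0 \text{ for } 1\le\ell\le s,\ 0\le k\le m,\text{ and for all } i \text{ and all } j\le N_m:\ a_{ij}=0\iff j\notin S_i\}. \] Then $A_{\infty,S}$ is the set of (normalized) coefficient sequences of the solutions of $G$ whose supports are exactly $S$, i.e. \[ \Psi(A_{\infty,S})=\{\varphi\in\mathrm{Sol}(G) : \{j : \text{the coefficient of } t^j \text{ in } \varphi_i \text{ is nonzero}\}=S_i \text{ for } i=1,\dots,n\}, \] and $A_{\infty,S}$ is nonempty if and only if $A_{m,S}$ is nonempty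 for every $m\in\mathbb{Z}_{\ge0}$. -/

import Mathlib

open scoped PowerSeries

noncomputable section

namespace DiffTrop

/-! ### Differential polynomials -/

/-- The ring `A{x_1, …, x_n}` of differential polynomials: polynomials over `A` in the variables
`x_{ij}`, where `(i, j) : Fin n × ℕ` stands for the `j`-th derivative of the `i`-th variable. -/
abbrev DiffPoly (A : Type*) [CommRing A] (n : ℕ) : Type _ := MvPolynomial (Fin n × ℕ) A

section Derivation

variable {k A σ : Type*} [CommRing k] [CommRing A] [Algebra k A]

/-- Apply the derivation `d` of `A` to every coefficient of a polynomial. -/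
def coeffDer (d : Derivation k A A) (P : MvPolynomial σ A) : MvPolynomial σ A :=
  ∑ m ∈ P.support, MvPolynomial.monomial m (d (P.coeff m))

theorem coeff_coeffDer (d : Derivation k A A) (P : MvPolynomial σ A) (m : σ →₀ ℕ) :
    (coeffDer d P).coeff m = d (P.coeff m) := by
  classical
  simp only [coeffDer, MvPolynomial.coeff_sum, MvPolynomial.coeff_monomial,
    Finset.sum_ite_eq', MvPolynomial.mem_support_iff]
  split_ifs with h
  · rfl
  · rw [not_not.mp h, map_zero]

theorem coeffDer_mul (d : Derivation k A A) (P Q : MvPolynomial σ A) :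
    coeffDer d (P * Q) = P * coeffDer d Q + Q * coeffDer d P := by
  classical
  rw [mul_comm Q]
  ext m
  simp only [coeff_coeffDer, MvPolynomial.coeff_add, MvPolynomial.coeff_mul, map_sum,
    Derivation.leibniz, smul_eq_mul, Finset.sum_add_distrib]
  congr 1
  exact Finset.sum_congr rfl fun _ _ => mul_comm _ _

/-- The derivation of `A{x_1, …, x_n}` that extends the derivation `d` of `A` and sends `x_{ij}`
to `x_{i(j+1)}`. -/
def der (d : Derivation k A A) (n : ℕ) : Derivation k (DiffPoly A n) (DiffPoly A n) :=
  Derivation.mk'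
    { toFun := fun P => coeffDer d P +
        MvPolynomial.mkDerivation A (fun v : Fin n × ℕ => MvPolynomial.X (v.1, v.2 + 1)) P
      map_add' := fun P Q => by
        have h : coeffDer d (P + Q) = coeffDer d P + coeffDer d Q := by
          ext m; simp [coeff_coeffDer]
        rw [h, map_add]; abel
      map_smul' := fun c P => by
        have h : coeffDer d (c • P) = c • coeffDer d P := by
          ext m; simp [coeff_coeffDer, MvPolynomial.coeff_smul]
        rw [h, RingHom.id_apply, smul_add, ← algebraMap_smul A c P, Derivation.map_smul,
          algebraMap_smul] }
    (fun P Q => by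
      simp only [LinearMap.coe_mk, AddHom.coe_mk, coeffDer_mul, Derivation.leibniz, smul_eq_mul]
      ring)

theorem der_C (d : Derivation k A A) (n : ℕ) (a : A) :
    der d n (MvPolynomial.C a) = MvPolynomial.C (d a) := by
  classical
  have h : coeffDer d (MvPolynomial.C (σ := Fin n × ℕ) a) = MvPolynomial.C (d a) := by
    ext m
    simp only [coeff_coeffDer, MvPolynomial.coeff_C]
    split_ifs <;> simp
  change coeffDer d _ + _ = _
  rw [h, MvPolynomial.derivation_C, add_zero]

theorem der_X (d : Derivation k A A) (n : ℕ) (v : Fin n × ℕ) :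
    der d n (MvPolynomial.X v) = MvPolynomial.X (v.1, v.2 + 1) := by
  classical
  have h : coeffDer d (MvPolynomial.X v : DiffPoly A n) = 0 := by
    ext m
    simp only [coeff_coeffDer, MvPolynomial.coeff_X, MvPolynomial.coeff_zero]
    split_ifs <;> simp
  change coeffDer d _ + _ = _
  rw [h, MvPolynomial.mkDerivation_X, zero_add]

/-- The value `P(φ) ∈ A` of a differential polynomial at `φ ∈ A^n`: substitute `d^j φ_i` for
`x_{ij}`. -/
def value (d : Derivation k A A) {n : ℕ} (φ : Fin n → A) (P : DiffPoly A n) : A :=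
  MvPolynomial.eval (fun v => d^[v.2] (φ v.1)) P

/-- The set of solutions in `A^n` of a set of differential polynomials. -/
def Sol (d : Derivation k A A) {n : ℕ} (G : Set (DiffPoly A n)) : Set (Fin n → A) :=
  {φ | ∀ P ∈ G, value d φ P = 0}

/-- An ideal of `A{x_1, …, x_n}` is a differential ideal if it is closed under the derivation. -/
def IsDifferentialIdeal (d : Derivation k A A) {n : ℕ} (G : Ideal (DiffPoly A n)) : Prop :=
  ∀ P ∈ G, der d n P ∈ G

end Derivation

/-! ### Power series: supports and coefficient sequences -/

section Series

variable {K : Type*} [Field K] {n : ℕ}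

/-- The tropicalization of a tuple of power series: the tuple of its supports. -/
def trop (φ : Fin n → K⟦X⟧) : Fin n → Set ℕ :=
  fun i => {j | PowerSeries.coeff j (φ i) ≠ 0}

/-- The map `Ψ : (K^ℕ)^n → K⟦t⟧^n`, `(a_{ij}) ↦ (∑_j a_{ij} t^j / j!)_i`. -/
def Psi (a : Fin n → ℕ → K) : Fin n → K⟦X⟧ :=
  fun i => PowerSeries.mk fun j => a i j / (j.factorial : K)

/-! ### The arc space, the jets, and their intersections with tori -/

variable {s : ℕ} (f : Fin s → DiffPoly K⟦X⟧ n)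

/-- `F_{ℓk} = (d^k f_ℓ)|_{t=0}`, a polynomial over `K` in the variables `x_{ij}`. -/
def jetPoly (l : Fin s) (k : ℕ) : MvPolynomial (Fin n × ℕ) K :=
  MvPolynomial.map PowerSeries.constantCoeff ((der (PowerSeries.derivative K) n)^[k] (f l))

/-- `A_∞`: the common zeros in `(K^ℕ)^n` of all the `F_{ℓk}`. -/
def arcs : Set (Fin n → ℕ → K) :=
  {a | ∀ l k, MvPolynomial.eval (fun v => a v.1 v.2) (jetPoly f l k) = 0}

/-- `A_{∞,S}`: the points of `A_∞` with `a_{ij} = 0` if and only if `j ∉ S_i`. -/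
def arcsTorus (S : Fin n → Set ℕ) : Set (Fin n → ℕ → K) :=
  {a | a ∈ arcs f ∧ ∀ i j, a i j = 0 ↔ j ∉ S i}

/-- `N_m`: the smallest positive integer `N` such that the `F_{ℓk}` with `k ≤ m` lie in
`K[x_{ij} : j ≤ N]`. -/
def jetOrder (m : ℕ) : ℕ :=
  sInf {N | 0 < N ∧ ∀ l, ∀ k ≤ m,
    jetPoly f l k ∈ MvPolynomial.supported K {v : Fin n × ℕ | v.2 ≤ N}}

theorem exists_jetOrder (m : ℕ) :
    {N | 0 < N ∧ ∀ l, ∀ k ≤ m,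
      jetPoly f l k ∈ MvPolynomial.supported K {v : Fin n × ℕ | v.2 ≤ N}}.Nonempty := by
  classical
  refine ⟨1 + ∑ l, ∑ k ∈ Finset.range (m + 1), (jetPoly f l k).vars.sup Prod.snd,
    by omega, fun l k hk => ?_⟩
  rw [MvPolynomial.mem_supported]
  intro v hv
  have h1 : v.2 ≤ (jetPoly f l k).vars.sup Prod.snd :=
    Finset.le_sup (f := Prod.snd) (Finset.mem_coe.mp hv)
  have h2 : (jetPoly f l k).vars.sup Prod.snd ≤
      ∑ k ∈ Finset.range (m + 1), (jetPoly f l k).vars.sup Prod.snd :=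
    Finset.single_le_sum (f := fun k => (jetPoly f l k).vars.sup Prod.snd)
      (fun _ _ => Nat.zero_le _) (Finset.mem_range.mpr (by omega))
  have h3 : ∑ k ∈ Finset.range (m + 1), (jetPoly f l k).vars.sup Prod.snd ≤
      ∑ l, ∑ k ∈ Finset.range (m + 1), (jetPoly f l k).vars.sup Prod.snd :=
    Finset.single_le_sum
      (f := fun l => ∑ k ∈ Finset.range (m + 1), (jetPoly f l k).vars.sup Prod.snd)
      (fun _ _ => Nat.zero_le _) (Finset.mem_univ l)
  simp only [Set.mem_ofPred_eq]
  omega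

/-- The value at a point `a = (a_{ij})_{j ≤ N}` of a polynomial in the variables `x_{ij}`. It is
only used for polynomials that do not involve the variables `x_{ij}` with `j > N`, so the value `0`
given to these variables is immaterial; see `evalTrunc_eq`. -/
def evalTrunc {N : ℕ} (a : Fin n → Fin (N + 1) → K) (F : MvPolynomial (Fin n × ℕ) K) : K :=
  MvPolynomial.eval (fun v => if h : v.2 < N + 1 then a v.1 ⟨v.2, h⟩ else 0) F

theorem evalTrunc_eq {N : ℕ} (a : Fin n → Fin (N + 1) → K) (F : MvPolynomial (Fin n × ℕ) K)
    (hF : F ∈ MvPolynomial.supported K {v : Fin n × ℕ | v.2 ≤ N}) (b : Fin n → ℕ → K)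
    (hb : ∀ i (j : Fin (N + 1)), b i j = a i j) :
    evalTrunc a F = MvPolynomial.eval (fun v => b v.1 v.2) F := by
  rw [MvPolynomial.mem_supported] at hF
  refine MvPolynomial.eval₂Hom_congr' rfl (fun v hv _ => ?_) rfl
  have h : v.2 < N + 1 := Nat.lt_succ_of_le (hF (Finset.mem_coe.mpr hv))
  rw [dif_pos h]
  exact (hb v.1 ⟨v.2, h⟩).symm

/-- `A_m`: the common zeros in `(K^{N_m+1})^n` of the `F_{ℓk}` with `k ≤ m`. -/
def jets (m : ℕ) : Set (Fin n → Fin (jetOrder f m + 1) → K) :=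
  {a | ∀ l, ∀ k ≤ m, evalTrunc a (jetPoly f l k) = 0}

/-- `A_{m,S}`: the points of `A_m` with `a_{ij} = 0` if and only if `j ∉ S_i` (`j ≤ N_m`). -/
def jetsTorus (S : Fin n → Set ℕ) (m : ℕ) : Set (Fin n → Fin (jetOrder f m + 1) → K) :=
  {a | a ∈ jets f m ∧ ∀ (i : Fin n) (j : Fin (jetOrder f m + 1)), a i j = 0 ↔ (j : ℕ) ∉ S i}

end Series

end DiffTrop

end

noncomputable section

namespace DiffTrop

/-! ### Systems of countably many polynomial equations over an uncountable field -/

section Nullstellensatz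

open Cardinal

universe u

/-! Evaluation at `Psi a` commutes with the derivations, so `F_{ℓk}(a)` is `k!` times the `k`-th
coefficient of `f_ℓ(Psi a)` (`eval_jetPoly`). In characteristic zero `k!` is invertible and `Psi` is
onto and preserves supports, which gives the description of the solutions. For nonemptiness, a point
of `A_{∞,S}` truncates to each `A_{m,S}`. Conversely, finitely many equations have bounded `k`, and
a point of some `A_{m,S}`, padded beyond `N_m`, solves them. The whole countable system is then
solvable by a Nullstellensatz in countably many variables (`exists_zero_of_finite`): residue fields
have countable dimension over the uncountable field `K`, hence equal `K`. -/

/-- An algebra of countable dimension over an uncountable field is algebraic if it is a field. -/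
theorem isAlgebraic_of_rank_le_aleph0 {K : Type u} {L : Type*} [Field K] [Uncountable K] [Field L]
    [Algebra K L] (h : Module.rank K L ≤ ℵ₀) : Algebra.IsAlgebraic K L := by
  rw [Algebra.isAlgebraic_def]
  intro x
  by_contra hx
  -- For transcendental `x`, the inverses of `x - c` with `c ∈ K` form an uncountable independent
  -- family.
  have h1 := Transcendental.linearIndependent_sub_inv hx |>.cardinal_lift_le_rank
  have h2 := h1.trans (Cardinal.lift_le.mpr h)
  rw [Cardinal.lift_aleph0, Cardinal.lift_le_aleph0] at h2
  exact (Cardinal.aleph0_lt_mk_iff.mpr ‹_›).not_ge h2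

theorem rank_mvPolynomial_le_aleph0 (K : Type*) [Field K] (τ : Type*) [Countable τ] :
    Module.rank K (MvPolynomial τ K) ≤ ℵ₀ := by
  have h := (MvPolynomial.basisMonomials τ K).mk_eq_rank
  have hc : #(τ →₀ ℕ) ≤ ℵ₀ := Cardinal.mk_le_aleph0
  rw [← Cardinal.lift_le_aleph0, ← h, Cardinal.lift_le_aleph0]
  exact hc

/-- A proper ideal of a polynomial ring in countably many variables over an uncountable
algebraically closed field has a zero. -/
theorem exists_zero_of_ne_top {K : Type*} [Field K] [IsAlgClosed K] [Uncountable K] {τ : Type*}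
    [Countable τ] {I : Ideal (MvPolynomial τ K)} (hI : I ≠ ⊤) :
    ∃ a : τ → K, ∀ p ∈ I, MvPolynomial.eval a p = 0 := by
  obtain ⟨M, hM, hIM⟩ := Ideal.exists_le_maximal I hI
  let _ : Field (MvPolynomial τ K ⧸ M) := Ideal.Quotient.field M
  have hr : Module.rank K (MvPolynomial τ K ⧸ M) ≤ ℵ₀ :=
    (LinearMap.rank_le_of_surjective (Ideal.Quotient.mkₐ K M).toLinearMap
      (Ideal.Quotient.mkₐ_surjective K M)).trans (rank_mvPolynomial_le_aleph0 K τ)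
  have := isAlgebraic_of_rank_le_aleph0 hr
  have hb := IsAlgClosed.algebraMap_bijective_of_isIntegral (k := K) (K := MvPolynomial τ K ⧸ M)
  -- The residue field is `K`, so the residues of the variables are the coordinates of a zero.
  choose a ha using fun v : τ => hb.2 (Ideal.Quotient.mk M (MvPolynomial.X v))
  refine ⟨a, fun p hp => hb.1 ?_⟩
  have h : (Algebra.ofId K (MvPolynomial τ K ⧸ M)).comp (MvPolynomial.aeval a) =
      Ideal.Quotient.mkₐ K M := by
    ext v
    simpa [Algebra.ofId_apply] using ha v
  have h2 := DFunLike.congr_fun h p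
  rw [AlgHom.comp_apply, Algebra.ofId_apply] at h2
  rw [map_zero]
  exact h2.trans (Ideal.Quotient.eq_zero_iff_mem.mpr (hIM hp))

/-- A system of polynomial equations in countably many variables over an uncountable
algebraically closed field is solvable if all its finite subsystems are. -/
theorem exists_zero_of_finite {K : Type*} [Field K] [IsAlgClosed K] [Uncountable K] {τ : Type*}
    [Countable τ] (P : Set (MvPolynomial τ K))
    (h : ∀ T : Finset (MvPolynomial τ K), (T : Set (MvPolynomial τ K)) ⊆ P →
      ∃ a : τ → K, ∀ p ∈ T, MvPolynomial.eval a p = 0) :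
    ∃ a : τ → K, ∀ p ∈ P, MvPolynomial.eval a p = 0 := by
  have hP : Ideal.span P ≠ ⊤ := by
    intro htop
    obtain ⟨T, hTP, hT⟩ := Submodule.mem_span_finite_of_mem_span
      ((Ideal.eq_top_iff_one _).mp htop)
    obtain ⟨a, ha⟩ := h T hTP
    have hle : Ideal.span (T : Set (MvPolynomial τ K)) ≤ RingHom.ker (MvPolynomial.eval a) :=
      Ideal.span_le.mpr fun p hp => ha p hp
    have h1 : MvPolynomial.eval a (1 : MvPolynomial τ K) = 0 := hle hT
    exact one_ne_zero ((map_one (MvPolynomial.eval a)).symm.trans h1)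
  obtain ⟨a, ha⟩ := exists_zero_of_ne_top hP
  exact ⟨a, fun p hp => ha p (Ideal.subset_span hp)⟩

/-- The same for zeros with a prescribed set `S` of nonzero coordinates. -/
theorem exists_zero_support_of_finite {K : Type*} [Field K] [IsAlgClosed K] [Uncountable K]
    {σ : Type*} [Countable σ] (S : Set σ) (P : Set (MvPolynomial σ K))
    (h : ∀ T : Finset (MvPolynomial σ K), (T : Set (MvPolynomial σ K)) ⊆ P →
      ∃ a : σ → K, (∀ p ∈ T, MvPolynomial.eval a p = 0) ∧ ∀ v, a v = 0 ↔ v ∉ S) :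
    ∃ a : σ → K, (∀ p ∈ P, MvPolynomial.eval a p = 0) ∧ ∀ v, a v = 0 ↔ v ∉ S := by
  classical
  -- Rabinowitsch trick: the second copy of the variables supplies inverses, turning nonvanishing on
  -- `S` into the equations `U`.
  let ren : MvPolynomial σ K → MvPolynomial (σ ⊕ σ) K := MvPolynomial.rename Sum.inl
  have hren : Function.Injective ren := MvPolynomial.rename_injective _ Sum.inl_injective
  let Z : Set (MvPolynomial (σ ⊕ σ) K) := (fun v => MvPolynomial.X (Sum.inl v)) '' Sᶜ
  let U : Set (MvPolynomial (σ ⊕ σ) K) :=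
    (fun v => MvPolynomial.X (Sum.inl v) * MvPolynomial.X (Sum.inr v) - 1) '' S
  obtain ⟨a, ha⟩ := exists_zero_of_finite (ren '' P ∪ (Z ∪ U)) fun T hT => by
    -- The filter is needed because the preimage of `T` may contain variables coming from `Z` that
    -- are not in `P`.
    obtain ⟨b, hb, hbS⟩ := h ((T.preimage ren hren.injOn).filter (· ∈ P)) (by
      intro p hp
      exact (Finset.mem_filter.mp hp).2)
    refine ⟨Sum.elim b fun v => (b v)⁻¹, fun p hp => ?_⟩
    rcases hT hp with ⟨q, hq, rfl⟩ | ⟨v, hv, rfl⟩ | ⟨v, hv, rfl⟩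
    · rw [MvPolynomial.eval_rename, Sum.elim_comp_inl]
      exact hb q (Finset.mem_filter.mpr ⟨Finset.mem_preimage.mpr hp, hq⟩)
    · simpa using (hbS v).mpr hv
    · have hne : b v ≠ 0 := fun h0 => (hbS v).mp h0 hv
      simp [hne]
  refine ⟨fun v => a (Sum.inl v), fun p hp => ?_, fun v => ⟨fun h0 hv => ?_, fun hv => ?_⟩⟩
  · have h1 := ha _ (Or.inl ⟨p, hp, rfl⟩)
    rwa [MvPolynomial.eval_rename] at h1
  · have h1 := ha _ (Or.inr (Or.inr ⟨v, hv, rfl⟩))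
    simp [h0] at h1
  · simpa using ha _ (Or.inr (Or.inl ⟨v, hv, rfl⟩))

end Nullstellensatz

/-! ### Solutions and Taylor coefficients -/

/-- By additivity and the Leibniz rule it suffices to compare constants and variables. -/
theorem value_der {k A : Type*} [CommRing k] [CommRing A] [Algebra k A] (d : Derivation k A A)
    {n : ℕ} (φ : Fin n → A) (P : DiffPoly A n) : value d φ (der d n P) = d (value d φ P) := by
  unfold value
  induction P using MvPolynomial.induction_on with
  | C a => simp [der_C]
  | add p q hp hq => simp only [map_add, hp, hq]
  | mul_X p v hp =>
    simp only [Derivation.leibniz, smul_eq_mul, map_add, map_mul, hp, der_X, MvPolynomial.eval_X,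
      Function.iterate_succ_apply']

theorem value_der_iterate {k A : Type*} [CommRing k] [CommRing A] [Algebra k A]
    (d : Derivation k A A) {n : ℕ} (φ : Fin n → A) (P : DiffPoly A n) (m : ℕ) :
    value d φ ((der d n)^[m] P) = d^[m] (value d φ P) := by
  induction m with
  | zero => rfl
  | succ m ih => rw [Function.iterate_succ_apply', value_der, ih, Function.iterate_succ_apply']

section Series

variable {K : Type*} [Field K] {n : ℕ}

theorem coeff_Psi (a : Fin n → ℕ → K) (i : Fin n) (j : ℕ) :
    PowerSeries.coeff j (Psi a i) = a i j / (j.factorial : K) := PowerSeries.coeff_mk _ _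

theorem constantCoeff_derivative_Psi [CharZero K] (a : Fin n → ℕ → K) (i : Fin n) (j : ℕ) :
    PowerSeries.constantCoeff ((PowerSeries.derivative K)^[j] (Psi a i)) = a i j := by
  have hj : (j.factorial : K) ≠ 0 := Nat.cast_ne_zero.mpr j.factorial_ne_zero
  rw [PowerSeries.constantCoeff_iterate_derivative, coeff_Psi, mul_div_cancel₀ _ hj]

theorem Psi_surjective [CharZero K] : Function.Surjective (Psi : (Fin n → ℕ → K) → _) := by
  intro φ
  refine ⟨fun i j => PowerSeries.coeff j (φ i) * (j.factorial : K), ?_⟩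
  funext i
  ext j
  have hj : (j.factorial : K) ≠ 0 := Nat.cast_ne_zero.mpr j.factorial_ne_zero
  rw [coeff_Psi, mul_div_cancel_right₀ _ hj]

theorem trop_Psi_eq_iff [CharZero K] (a : Fin n → ℕ → K) (S : Fin n → Set ℕ) :
    trop (Psi a) = S ↔ ∀ i j, a i j = 0 ↔ j ∉ S i := by
  have h : ∀ i j, j ∈ trop (Psi a) i ↔ a i j ≠ 0 := fun i j => by
    have hj : (j.factorial : K) ≠ 0 := Nat.cast_ne_zero.mpr j.factorial_ne_zero
    change PowerSeries.coeff j (Psi a i) ≠ 0 ↔ _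
    rw [coeff_Psi, Ne, div_eq_zero_iff, or_iff_left hj]
  simp only [funext_iff, Set.ext_iff, h, ne_eq]
  exact forall₂_congr fun i j => not_iff_comm.trans iff_comm

variable {s : ℕ} (f : Fin s → DiffPoly K⟦X⟧ n)

/-- The jet polynomials compute the Taylor coefficients of `f_ℓ(Ψ(a))`. -/
theorem eval_jetPoly [CharZero K] (a : Fin n → ℕ → K) (l : Fin s) (k : ℕ) :
    MvPolynomial.eval (fun v => a v.1 v.2) (jetPoly f l k) =
      k.factorial * PowerSeries.coeff k (value (PowerSeries.derivative K) (Psi a) (f l)) := by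
  rw [← PowerSeries.constantCoeff_iterate_derivative, ← value_der_iterate, jetPoly, value,
    MvPolynomial.eval_map, ← MvPolynomial.eval₂_id, MvPolynomial.hom_eval₂, RingHom.comp_id]
  simp only [constantCoeff_derivative_Psi]

theorem mem_arcs_iff [CharZero K] (a : Fin n → ℕ → K) :
    a ∈ arcs f ↔ Psi a ∈ ⋂ l, Sol (PowerSeries.derivative K) {f l} := by
  have hk : ∀ k : ℕ, (k.factorial : K) ≠ 0 := fun k => Nat.cast_ne_zero.mpr k.factorial_ne_zero
  simp only [arcs, Set.mem_ofPred_eq, eval_jetPoly, mul_eq_zero, hk, false_or, Set.mem_iInter, Sol,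
    Set.mem_singleton_iff, forall_eq, PowerSeries.ext_iff, map_zero]

theorem jetPoly_mem_supported (l : Fin s) {k m : ℕ} (hkm : k ≤ m) :
    jetPoly f l k ∈ MvPolynomial.supported K {v : Fin n × ℕ | v.2 ≤ jetOrder f m} :=
  (Nat.sInf_mem (exists_jetOrder f m)).2 l k hkm

theorem jetsTorus_nonempty (S : Fin n → Set ℕ) (h : (arcsTorus f S).Nonempty) (m : ℕ) :
    (jetsTorus f S m).Nonempty := by
  obtain ⟨a, ha, haS⟩ := h
  refine ⟨fun i j => a i j, fun l k hk => ?_, fun i j => haS i j⟩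
  rw [evalTrunc_eq _ _ (jetPoly_mem_supported f l hk) a fun _ _ => rfl]
  exact ha l k

/-- A point of `A_{m,S}` extends to a sequence with supports `S`. -/
theorem exists_extension_of_jetsTorus (S : Fin n → Set ℕ) (m : ℕ)
    (h : (jetsTorus f S m).Nonempty) :
    ∃ b : Fin n × ℕ → K, (∀ l, ∀ k ≤ m, MvPolynomial.eval b (jetPoly f l k) = 0) ∧
      ∀ v, b v = 0 ↔ v.2 ∉ S v.1 := by
  classical
  obtain ⟨a, ha, haS⟩ := h
  -- The equations with `k ≤ m` do not see the entries beyond `N_m`, so any values with the right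
  -- support will do.
  let b : Fin n → ℕ → K := fun i j =>
    if h : j < jetOrder f m + 1 then a i ⟨j, h⟩ else if j ∈ S i then 1 else 0
  refine ⟨fun v => b v.1 v.2, fun l k hk => ?_, fun v => ?_⟩
  · rw [← evalTrunc_eq a _ (jetPoly_mem_supported f l hk) b fun i j => dif_pos j.2]
    exact ha l k hk
  · by_cases hv : v.2 < jetOrder f m + 1
    · simpa only [b, dif_pos hv] using haS v.1 ⟨v.2, hv⟩
    · simp only [b, dif_neg hv, ite_eq_right_iff, one_ne_zero, imp_false]

theorem arcsTorus_nonempty [IsAlgClosed K] [Uncountable K] (S : Fin n → Set ℕ)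
    (h : ∀ m, (jetsTorus f S m).Nonempty) : (arcsTorus f S).Nonempty := by
  classical
  obtain ⟨a, ha, haS⟩ := exists_zero_support_of_finite {v : Fin n × ℕ | v.2 ∈ S v.1}
    ((fun q : Fin s × ℕ => jetPoly f q.1 q.2) '' Set.univ) fun T hT => by
      obtain ⟨Q, -, rfl⟩ := Finset.subset_set_image_iff.mp hT
      -- The level `m` is the largest `k` occurring in the finite subsystem.
      obtain ⟨b, hb, hbS⟩ := exists_extension_of_jetsTorus f S (Q.sup Prod.snd) (h _)
      refine ⟨b, fun p hp => ?_, hbS⟩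
      obtain ⟨q, hq, rfl⟩ := Finset.mem_image.mp hp
      exact hb q.1 q.2 (Finset.le_sup (f := Prod.snd) hq)
  exact ⟨fun i j => a (i, j), fun l k => ha _ ⟨(l, k), trivial, rfl⟩, fun i j => haS (i, j)⟩

end Series

end DiffTrop

end

theorem mainTheorem2 {K : Type*} [Field K] [IsAlgClosed K] [CharZero K] [Uncountable K]
    (n : ℕ) (G : Ideal (DiffTrop.DiffPoly K⟦X⟧ n))
    (hG : DiffTrop.IsDifferentialIdeal (PowerSeries.derivative K) G)
    (s : ℕ) (f : Fin s → DiffTrop.DiffPoly K⟦X⟧ n) (hfG : ∀ l, f l ∈ G)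
    (hf : DiffTrop.Sol (PowerSeries.derivative K) (G : Set (DiffTrop.DiffPoly K⟦X⟧ n)) =
      ⋂ l, DiffTrop.Sol (PowerSeries.derivative K) {f l})
    (S : Fin n → Set ℕ) :
    DiffTrop.Psi '' DiffTrop.arcsTorus f S =
        {φ | φ ∈ DiffTrop.Sol (PowerSeries.derivative K)
            (G : Set (DiffTrop.DiffPoly K⟦X⟧ n)) ∧ DiffTrop.trop φ = S} ∧
      ((DiffTrop.arcsTorus f S).Nonempty ↔ ∀ m : ℕ, (DiffTrop.jetsTorus f S m).Nonempty) := by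
  refine ⟨?_, fun h m => DiffTrop.jetsTorus_nonempty f S h m,
    DiffTrop.arcsTorus_nonempty f S⟩
  rw [hf]
  ext φ
  constructor
  · rintro ⟨a, ⟨ha, haS⟩, rfl⟩
    exact ⟨(DiffTrop.mem_arcs_iff f a).mp ha, (DiffTrop.trop_Psi_eq_iff a S).mpr haS⟩
  · rintro ⟨hφ, hS⟩
    obtain ⟨a, rfl⟩ := DiffTrop.Psi_surjective φ
    exact ⟨a, ⟨(DiffTrop.mem_arcs_iff f a).mpr hφ, (DiffTrop.trop_Psi_eq_iff a S).mp hS⟩, rfl⟩
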